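/- Let $m\ge 0$, $n\ge 3$, $q\ge 0$ and $r\ge 1$ be integers; if $m\ge 3$, suppose moreover that $$n>2m+\frac{-1+\sqrt{8m^2-16m-7}}{2}.$$ For an integer $N$, let $K_N^3$ be the hypergraph with $N$ vertices whose hyperedges are all the 3-element sets of vertices. An $r$-factor of $K_n^3$ is a set of hyperedges (together with all $n$ vertices) such that every vertex lies in exactly $r$ of them, and an $r$-factorization of $K_n^3$ is a set of $r$-factors that partition the hyperedges of $K_n^3$. Let $c$ be a $q$-hyperedge-coloring of $K_m^3$, that is, a map from the hyperedges of $K_m^3$ to $\{1,\dots,q\}$ (not necessarily onto), and let $d_j(v)$ be the number of hyperedges of color $j$ that contain the vertex $v$. Say that $c$ can be embedded into an $r$-factorization of $K_n^3$ if there are an $r$-factorization of $K_n^3$, an injection of the vertices of $K_m^3$ into those of $K_n^3$, and an injection from $\{1,\dots,q\}$ to the set of $r$-factors, such that every hyperedge of $K_m^3$ of color $j$ is mapped to a hyperedge of the $r$-factor assigned to $j$. Then $c$ can be embedded into an $r$-factorization of $K_n^3$ if and only if the following four conditions hold: (i) $3\mid rn$; (ii) $r\mid \binom{n-1}{2}$;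 (iii) $q\le \binom{n-1}{2}/r$; (iv) $d_j(v)\le r$ for every vertex $v$ of $K_m^3$ and every $1\le j\le q$. -/

import Mathlib

namespace Hypergraph

/-- The complete `k`-uniform hypergraph `K_n^k` of order `n`: its vertices are the `n` elements of
`Fin n`, and every `k`-element set of vertices is a hyperedge (exactly once). -/
def completeUniform (n k : ℕ) : Hypergraph (Fin n) where
  vertexSet := Set.univ
  edgeSet := {e | e.ncard = k}
  subset_vertexSet_of_mem_edgeSet' := fun e _ => Set.subset_univ e

/-- The degree of a vertex of a (finite) hypergraph: the number of hyperedges that contain it. -/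
noncomputable def degree {α : Type*} (H : Hypergraph α) (v : α) : ℕ :=
  {e | e ∈ E(H) ∧ v ∈ e}.ncard

/-- A hypergraph is `r`-regular if every vertex has degree `r`. -/
def IsRegular {α : Type*} (H : Hypergraph α) (r : ℕ) : Prop :=
  ∀ v ∈ V(H), H.degree v = r

/-- `H` is a sub-hypergraph of `G`. -/
def IsSubhypergraph {α : Type*} (H G : Hypergraph α) : Prop :=
  V(H) ⊆ V(G) ∧ E(H) ⊆ E(G)

/-- An `r`-factor of `G` is an `r`-regular spanning sub-hypergraph of `G`. -/
def IsFactor {α : Type*} (G : Hypergraph α) (r : ℕ) (H : Hypergraph α) : Prop :=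
  H.IsSubhypergraph G ∧ V(H) = V(G) ∧ H.IsRegular r

/-- An `r`-factorization of `G` is a set of `r`-factors of `G` whose edge sets partition the edge
set of `G`. -/
def IsFactorization {α : Type*} (G : Hypergraph α) (r : ℕ) (S : Set (Hypergraph α)) : Prop :=
  (∀ H ∈ S, G.IsFactor r H) ∧ ∀ e ∈ E(G), ∃! H : Hypergraph α, H ∈ S ∧ e ∈ E(H)

/-- A `q`-hyperedge-coloring of `G`: a map from the hyperedges to a set of `q` colors (not
necessarily onto). -/
abbrev EdgeColoring {α : Type*} (G : Hypergraph α) (q : ℕ) : Type _ :=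
  E(G) → Fin q

/-- The sub-hypergraph `G(j)` formed by the hyperedges of color `j`, on all vertices of `G`. -/
def colorClass {α : Type*} (G : Hypergraph α) {q : ℕ} (c : G.EdgeColoring q) (j : Fin q) :
    Hypergraph α where
  vertexSet := V(G)
  edgeSet := {e | ∃ he : e ∈ E(G), c ⟨e, he⟩ = j}
  subset_vertexSet_of_mem_edgeSet' := fun _ h =>
    G.subset_vertexSet_of_mem_edgeSet' h.choose

/-- The `q`-hyperedge-coloring `c` of `F` can be embedded into an `r`-factorization of `G`: the
vertices of `F` can be identified (injectively, through `f`) with vertices of `G`, and the `q` colors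
with distinct `r`-factors (through `φ`) of some `r`-factorization of `G`, in such a way that each
color class of `F` is a sub-hypergraph of the `r`-factor of its color. -/
def EmbedsInFactorization {α β : Type*} (F : Hypergraph α) {q : ℕ} (c : F.EdgeColoring q)
    (G : Hypergraph β) (r : ℕ) : Prop :=
  ∃ S : Set (Hypergraph β), G.IsFactorization r S ∧
    ∃ f : α → β, Set.InjOn f V(F) ∧ Set.MapsTo f V(F) V(G) ∧
      ∃ φ : Fin q → Hypergraph β, Function.Injective φ ∧ (∀ j, φ j ∈ S) ∧
        ∀ j, ((F.colorClass c j).image f).IsSubhypergraph (φ j)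

end Hypergraph

/-!
Necessity is counting: each vertex lies in `(n - 1).choose 2` hyperedges and in `r` of every factor,
an `r`-factor has `r * n / 3` hyperedges, and an embedding cannot decrease degrees
(`Hypergraph.necessary_of_embedsInFactorization`).

For sufficiency, let `V` be the image of the vertices of `K_m^3` in those of `K_n^3`, and identify
the `n - m` other vertices with one another, giving a vertex `∞`. The hyperedges become multisets
`A ∪ {∞, …, ∞}` with `A ⊆ V`, occurring `(n - m).choose (3 - #A)` times. Those with `#A = 3` are
colored already. Those with `#A = 2` are colored greedily so that no degree exceeds `r`; the lower
bound on `n` is what makes this possible (`exists_pair_coloring`). Those with `#A = 1` bring all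
degrees in `V` to `r`, and those with `A = ∅` bring each color class to `r * n / 3` hyperedges;
the divisibility conditions make all counts come out right (`exists_isAmalgamation_three`). There is
room for the last step since `3 * m ≤ n`, except when `m = 3` and `n = 8`, where the greedy coloring
has to start from a suitable distribution of pairs over the colors
(`exists_pairs_of_card_eq_three`).

The vertices are then split off from `∞` one by one, as in the proof of Baranyai's theorem by
Brouwer and Schrijver (`IsAmalgamation.exists_insert`). To split off `v` when `∞` stands for `s`
vertices, one has to choose which copies of `A ∪ {∞, …, ∞}` in each color pass one of their `∞` to
`v`. Passing the fraction `(3 - #A) / s` of the copies is right on average, and has integral row and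
column sums as a matrix indexed by the sets `A` and the colors; integrality of the transportation
polytope (`exists_nat_matrix_of_real`) provides an integral choice with the same sums. When all
vertices have been split off, the coloring of the triples is an `r`-factorization, and triples in
`V` have kept their colors. For `m < 3` no triple is colored in advance, and `V = ∅` serves.
-/

/-! ### Integral points of transportation polytopes -/

section Rounding

variable {ι κ : Type*} [Fintype ι] [Fintype κ]

/-- If a summand of an integral sum is not an integer, then neither is some other summand. -/
lemma exists_ne_notMem_range_intCast (f : ι → ℝ) (N : ℤ) (hN : ∑ i, f i = N) {i : ι}
    (hi : f i ∉ Set.range ((↑) : ℤ → ℝ)) : ∃ i' ≠ i, f i' ∉ Set.range ((↑) : ℤ → ℝ) := by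
  classical
  by_contra! H
  choose! g hg using H
  refine hi ⟨N - ∑ i' ∈ Finset.univ.erase i, g i', ?_⟩
  rw [← Finset.add_sum_erase _ _ (Finset.mem_univ i)] at hN
  have : ∑ i' ∈ Finset.univ.erase i, f i' = ∑ i' ∈ Finset.univ.erase i, (g i' : ℝ) :=
    Finset.sum_congr rfl fun i' hi' => (hg i' (Finset.ne_of_mem_erase hi')).symm
  push_cast
  linarith

/-- A nonempty set `F` of cells of a matrix that meets no row and no column in exactly one cell
carries a nonzero real matrix all of whose row and column sums vanish. There are at least as many
cells in `F` as rows and columns met by `F`, and the row and column sums satisfy a linear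
relation. -/
lemma exists_ne_zero_rowSum_colSum_eq_zero (F : Finset (ι × κ)) (hF : F.Nonempty)
    (hrow : ∀ p ∈ F, ∃ p' ∈ F, p'.1 = p.1 ∧ p' ≠ p)
    (hcol : ∀ p ∈ F, ∃ p' ∈ F, p'.2 = p.2 ∧ p' ≠ p) :
    ∃ w : ι → κ → ℝ, w ≠ 0 ∧ (∀ i j, (i, j) ∉ F → w i j = 0) ∧
      (∀ i, ∑ j, w i j = 0) ∧ ∀ j, ∑ i, w i j = 0 := by
  classical
  set I := F.image Prod.fst with hI
  set J := F.image Prod.snd with hJ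
  have hIF : 2 * I.card ≤ F.card := by
    refine Finset.mul_card_image_le_card _ _ fun i hi => ?_
    obtain ⟨p, hp, rfl⟩ := Finset.mem_image.1 hi
    obtain ⟨p', hp', h1, h2⟩ := hrow p hp
    exact Finset.one_lt_card.2 ⟨p, by simp [hp], p', by simp [hp', h1], h2.symm⟩
  have hJF : 2 * J.card ≤ F.card := by
    refine Finset.mul_card_image_le_card _ _ fun i hi => ?_
    obtain ⟨p, hp, rfl⟩ := Finset.mem_image.1 hi
    obtain ⟨p', hp', h1, h2⟩ := hcol p hp
    exact Finset.one_lt_card.2 ⟨p, by simp [hp], p', by simp [hp', h1], h2.symm⟩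
  let L : (F → ℝ) →ₗ[ℝ] (I → ℝ) × (J → ℝ) :=
    { toFun := fun w => (fun i => ∑ p : F, if p.1.1 = i then w p else 0,
        fun j => ∑ p : F, if p.1.2 = j then w p else 0)
      map_add' := fun w w' => by
        ext <;> simp only [Pi.add_apply, Prod.mk_add_mk, ← Finset.sum_add_distrib] <;>
          exact Finset.sum_congr rfl fun p _ => by split_ifs <;> simp
      map_smul' := fun c w => by
        ext <;> simp only [Pi.smul_apply, Prod.smul_mk, RingHom.id_apply, smul_eq_mul,
          Finset.mul_sum] <;>
          exact Finset.sum_congr rfl fun p _ => by split_ifs <;> simp }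
  have hrel : ∀ w, ∑ i, (L w).1 i = ∑ j, (L w).2 j := by
    intro w
    simp only [L, LinearMap.coe_mk, AddHom.coe_mk]
    rw [Finset.sum_comm, Finset.sum_comm (s := (Finset.univ : Finset J))]
    refine Finset.sum_congr rfl fun p _ => ?_
    have h1 : p.1.1 ∈ I := Finset.mem_image_of_mem _ p.2
    have h2 : p.1.2 ∈ J := Finset.mem_image_of_mem _ p.2
    rw [Finset.sum_eq_single ⟨p.1.1, h1⟩, Finset.sum_eq_single ⟨p.1.2, h2⟩]
    · simp
    · intro b _ hb
      rw [if_neg fun h => hb (Subtype.ext h.symm)]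
    · simp
    · intro b _ hb
      rw [if_neg fun h => hb (Subtype.ext h.symm)]
    · simp
  -- an injective `L` would be onto, since the dimensions agree, in contradiction to `hrel`
  have hnotinj : ¬ Function.Injective L := by
    intro hinj
    have hle := LinearMap.finrank_le_finrank_of_injective hinj
    have hdim : Module.finrank ℝ (F → ℝ) = Module.finrank ℝ ((I → ℝ) × (J → ℝ)) := by
      simp at hle ⊢
      omega
    obtain ⟨p, hp⟩ := hF
    obtain ⟨w, hw⟩ := (LinearMap.injective_iff_surjective_of_finrank_eq_finrank hdim).1 hinj
      (Pi.single ⟨p.1, Finset.mem_image_of_mem _ hp⟩ 1, 0)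
    have := hrel w
    rw [hw] at this
    simp at this
  rw [← LinearMap.ker_eq_bot, Submodule.eq_bot_iff] at hnotinj
  push Not at hnotinj
  obtain ⟨w, hw, hw0⟩ := hnotinj
  rw [LinearMap.mem_ker] at hw
  have hfst : ∀ i : I, ∑ p : F, (if p.1.1 = i then w p else 0) = 0 := fun i =>
    congr_fun (congr_arg Prod.fst hw) i
  have hsnd : ∀ j : J, ∑ p : F, (if p.1.2 = j then w p else 0) = 0 := fun j =>
    congr_fun (congr_arg Prod.snd hw) j
  have hext : ∀ g : ι × κ → Prop, [DecidablePred g] →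
      ∑ p : ι × κ, (if g p then (if h : p ∈ F then w ⟨p, h⟩ else 0) else 0)
        = ∑ p : F, if g p.1 then w p else 0 := by
    intro g _
    rw [← Finset.sum_subset (Finset.subset_univ F)
      (fun p _ hp => by simp [hp]), ← Finset.sum_coe_sort]
    simp
  refine ⟨fun i j => if h : (i, j) ∈ F then w ⟨(i, j), h⟩ else 0, ?_, ?_, ?_, ?_⟩
  · obtain ⟨p, hp⟩ := Function.ne_iff.1 hw0
    intro h
    have := congr_fun (congr_fun h p.1.1) p.1.2
    simp only [Prod.mk.eta, Subtype.coe_eta, Finset.coe_mem, dite_true, Pi.zero_apply] at this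
    exact hp this
  · intro i j hij
    simp [hij]
  · intro i
    have key := hext fun p => p.1 = i
    rw [Fintype.sum_prod_type, Finset.sum_eq_single i] at key
    · simp only [if_true] at key
      rw [key]
      by_cases hi : i ∈ I
      · exact hfst ⟨i, hi⟩
      · refine Finset.sum_eq_zero fun p _ => if_neg ?_
        rintro rfl
        exact hi (Finset.mem_image_of_mem _ p.2)
    · intro b _ hb
      simp [hb]
    · simp
  · intro j
    have key := hext fun p => p.2 = j
    rw [Fintype.sum_prod_type_right, Finset.sum_eq_single j] at key
    · simp only [if_true] at key
      rw [key]
      by_cases hj : j ∈ J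
      · exact hsnd ⟨j, hj⟩
      · refine Finset.sum_eq_zero fun p _ => if_neg ?_
        rintro rfl
        exact hj (Finset.mem_image_of_mem _ p.2)
    · intro b _ hb
      simp [hb]
    · simp

/-- Integrality of the transportation polytope: a real matrix lying between `0` and a matrix `x` of
natural numbers, with integral row and column sums, can be replaced by a matrix of natural numbers
that is still at most `x` and has the same row and column sums. Every extreme point of the polytope
of such matrices is integral, since otherwise its fractional entries could be perturbed in two
opposite directions. -/
theorem exists_nat_matrix_of_real (x : ι → κ → ℕ) (z : ι → κ → ℝ) (h0 : ∀ i j, 0 ≤ z i j)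
    (hx : ∀ i j, z i j ≤ x i j) (R : ι → ℕ) (C : κ → ℕ) (hR : ∀ i, ∑ j, z i j = R i)
    (hC : ∀ j, ∑ i, z i j = C j) :
    ∃ y : ι → κ → ℕ, (∀ i j, y i j ≤ x i j) ∧ (∀ i, ∑ j, y i j = R i) ∧
      ∀ j, ∑ i, y i j = C j := by
  classical
  set P : Set (ι → κ → ℝ) := Set.Icc 0 (fun i j => (x i j : ℝ)) ∩
    ({y | ∀ i, ∑ j, y i j = R i} ∩ {y | ∀ j, ∑ i, y i j = C j}) with hP
  have hcomp : IsCompact P := by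
    refine isCompact_Icc.inter_right (IsClosed.inter ?_ ?_)
    · simp only [Set.ofPred_forall]
      exact isClosed_iInter fun i => isClosed_eq (by fun_prop) continuous_const
    · simp only [Set.ofPred_forall]
      exact isClosed_iInter fun j => isClosed_eq (by fun_prop) continuous_const
  obtain ⟨y, hy⟩ := hcomp.extremePoints_nonempty ⟨z, ⟨fun i j => h0 i j, fun i j => hx i j⟩, hR, hC⟩
  rw [mem_extremePoints_iff_left] at hy
  obtain ⟨⟨⟨hy0, hyx⟩, hyR, hyC⟩, hext⟩ := hy
  have hint : ∀ i j, y i j ∈ Set.range ((↑) : ℤ → ℝ) := by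
    by_contra! H
    obtain ⟨i₀, j₀, hij₀⟩ := H
    set F : Finset (ι × κ) :=
      Finset.univ.filter fun p => y p.1 p.2 ∉ Set.range ((↑) : ℤ → ℝ) with hF
    obtain ⟨w, hw0, hwF, hwR, hwC⟩ := exists_ne_zero_rowSum_colSum_eq_zero F
      ⟨(i₀, j₀), by simpa [hF] using hij₀⟩
      (by
        rintro ⟨i, j⟩ hp
        obtain ⟨j', hj', h⟩ := exists_ne_notMem_range_intCast (fun j => y i j) (R i)
          (by exact_mod_cast hyR i) (i := j) (by simpa [hF] using hp)
        exact ⟨(i, j'), by simpa [hF] using h, rfl, by simpa using hj'⟩)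
      (by
        rintro ⟨i, j⟩ hp
        obtain ⟨i', hi', h⟩ := exists_ne_notMem_range_intCast (fun i => y i j) (C j)
          (by exact_mod_cast hyC j) (i := i) (by simpa [hF] using hp)
        exact ⟨(i', j), by simpa [hF] using h, rfl, by simpa using hi'⟩)
    have hlt : ∀ i j, (i, j) ∈ F → 0 < y i j ∧ y i j < x i j := by
      intro i j hp
      replace hp : y i j ∉ Set.range ((↑) : ℤ → ℝ) := by simpa [hF] using hp
      exact ⟨(hy0 i j).lt_of_ne fun h => hp ⟨0, by simpa using h⟩,
        (hyx i j).lt_of_ne fun h => hp ⟨x i j, by simpa using h.symm⟩⟩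
    have hev : ∀ᶠ ε : ℝ in nhds 0, ∀ i j,
        0 ≤ y i j + ε * w i j ∧ y i j + ε * w i j ≤ x i j := by
      refine Filter.eventually_all.2 fun i => Filter.eventually_all.2 fun j => ?_
      by_cases hp : (i, j) ∈ F
      · have ht : Filter.Tendsto (fun ε : ℝ => y i j + ε * w i j) (nhds 0) (nhds (y i j)) := by
          have : Continuous fun ε : ℝ => y i j + ε * w i j := by fun_prop
          simpa using this.tendsto 0
        exact ((ht.eventually_const_lt (hlt i j hp).1).and
          (ht.eventually_lt_const (hlt i j hp).2)).mono fun ε h => ⟨h.1.le, h.2.le⟩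
      · exact Filter.Eventually.of_forall fun ε => by
          rw [hwF i j hp]
          exact ⟨by simpa using hy0 i j, by simpa using hyx i j⟩
    obtain ⟨δ, hδ, hball⟩ := Metric.eventually_nhds_iff.1 hev
    have hmem : ∀ ε : ℝ, |ε| < δ → (fun i j => y i j + ε * w i j) ∈ P := by
      intro ε hε
      have := hball (y := ε) (by simpa using hε)
      refine ⟨⟨fun i j => (this i j).1, fun i j => (this i j).2⟩, fun i => ?_, fun j => ?_⟩
      · simp [Finset.sum_add_distrib, ← Finset.mul_sum, hwR, hyR i]
      · simp [Finset.sum_add_distrib, ← Finset.mul_sum, hwC, hyC j]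
    have heq := hext _ (hmem (δ / 2) (by rw [abs_of_pos (by positivity)]; linarith)) _
      (hmem (-(δ / 2)) (by rw [abs_neg, abs_of_pos (by positivity)]; linarith))
      ⟨1 / 2, 1 / 2, by norm_num, by norm_num, by norm_num, by
        ext i j
        simp only [Pi.add_apply, Pi.smul_apply, smul_eq_mul]
        ring⟩
    refine hw0 (funext fun i => funext fun j => ?_)
    have := congr_fun (congr_fun heq i) j
    simp only [add_eq_left, mul_eq_zero] at this
    exact this.resolve_left (by positivity)
  have hnat : ∀ i j, ∃ k : ℕ, (k : ℝ) = y i j := by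
    intro i j
    obtain ⟨k, hk⟩ := hint i j
    have : 0 ≤ k := by
      have : (0 : ℝ) ≤ y i j := hy0 i j
      rw [← hk] at this
      exact_mod_cast this
    exact ⟨k.toNat, by rw [← hk]; exact_mod_cast Int.toNat_of_nonneg this⟩
  choose Y hY using hnat
  refine ⟨Y, fun i j => ?_, fun i => ?_, fun j => ?_⟩
  · have : y i j ≤ (x i j : ℝ) := hyx i j
    rw [← hY i j] at this
    exact_mod_cast this
  · have := hyR i
    simp only [← hY] at this
    exact_mod_cast this
  · have := hyC j
    simp only [← hY] at this
    exact_mod_cast this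

end Rounding

/-- The version of `exists_nat_matrix_of_real` for matrices whose rows are indexed by a finset. -/
theorem Finset.exists_nat_matrix_of_real {ι κ : Type*} [Fintype κ] (s : Finset ι) (x : ι → κ → ℕ)
    (z : ι → κ → ℝ) (h0 : ∀ i ∈ s, ∀ j, 0 ≤ z i j) (hx : ∀ i ∈ s, ∀ j, z i j ≤ x i j)
    (R : ι → ℕ) (C : κ → ℕ) (hR : ∀ i ∈ s, ∑ j, z i j = R i) (hC : ∀ j, ∑ i ∈ s, z i j = C j) :
    ∃ y : ι → κ → ℕ, (∀ i ∈ s, ∀ j, y i j ≤ x i j) ∧ (∀ i ∈ s, ∑ j, y i j = R i) ∧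
      ∀ j, ∑ i ∈ s, y i j = C j := by
  classical
  obtain ⟨y, hyx, hyR, hyC⟩ := _root_.exists_nat_matrix_of_real (fun (i : s) j => x i j)
    (fun (i : s) j => z i j) (fun i => h0 i i.2) (fun i => hx i i.2) (fun i => R i) C
    (fun i => hR i i.2) (fun j => by rw [← hC j, ← Finset.sum_coe_sort s])
  refine ⟨fun i j => if h : i ∈ s then y ⟨i, h⟩ j else 0, fun i hi j => ?_, fun i hi => ?_,
    fun j => ?_⟩
  · simpa [hi] using hyx ⟨i, hi⟩ j
  · simpa [hi] using hyR ⟨i, hi⟩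
  · rw [← hyC j, ← Finset.sum_coe_sort s]
    simp

/-! ### Detaching vertices from an amalgamated vertex -/

/-- Double counting of the incidences between the elements and the weighted subsets of a set. -/
lemma Finset.sum_powerset_card_mul {α : Type*} [DecidableEq α] (V : Finset α)
    (x : Finset α → ℕ) :
    ∑ A ∈ V.powerset, A.card * x A = ∑ v ∈ V, ∑ A ∈ V.powerset with v ∈ A, x A := by
  simp only [Finset.sum_filter]
  rw [Finset.sum_comm]
  refine Finset.sum_congr rfl fun A hA => ?_
  rw [← Finset.sum_filter, Finset.filter_mem_eq_inter,
    Finset.inter_eq_right.2 (Finset.mem_powerset.1 hA), Finset.sum_const, smul_eq_mul]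

section Detachment

variable {α κ : Type*} [Fintype α] [DecidableEq α] [Fintype κ]

/-- Let all vertices outside `V` be amalgamated into one vertex `∞`, and let `x A j` be the number
of hyperedges of color `j` that consist of the vertices of `A ⊆ V` and of `h - #A` times the vertex
`∞`. Then `IsAmalgamation h e r V x` says that these are the hyperedges of the amalgamation of the
complete `h`-uniform hypergraph, that every color class has degree `r` at each vertex of `V`, and
that every color class has `e` hyperedges. -/
structure IsAmalgamation (h e r : ℕ) (V : Finset α) (x : Finset α → κ → ℕ) : Prop where
  mult : ∀ A ⊆ V, A.card ≤ h → ∑ j, x A j = (Vᶜ.card).choose (h - A.card)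
  zero : ∀ A ⊆ V, h < A.card → ∀ j, x A j = 0
  deg : ∀ v ∈ V, ∀ j, ∑ A ∈ V.powerset with v ∈ A, x A j = r
  tot : ∀ j, ∑ A ∈ V.powerset, x A j = e

namespace IsAmalgamation

variable {h e r : ℕ} {V : Finset α} {x : Finset α → κ → ℕ}

/-- Every color class has degree `r * #Vᶜ` at the amalgamated vertex. -/
lemma sum_mul_sub (H : IsAmalgamation h e r V x) (he : h * e = r * Fintype.card α) (j : κ) :
    ∑ A ∈ V.powerset, x A j * (h - A.card) = r * Vᶜ.card := by
  have h1 : ∑ A ∈ V.powerset, A.card * x A j = V.card * r := by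
    rw [Finset.sum_powerset_card_mul V fun A => x A j, Finset.sum_congr rfl fun v hv => H.deg v hv j]
    simp
  have h2 : ∑ A ∈ V.powerset, x A j * (h - A.card) + ∑ A ∈ V.powerset, A.card * x A j
      = h * ∑ A ∈ V.powerset, x A j := by
    rw [← Finset.sum_add_distrib, Finset.mul_sum]
    refine Finset.sum_congr rfl fun A hA => ?_
    rcases le_or_gt A.card h with hc | hc
    · obtain ⟨k, rfl⟩ := Nat.exists_eq_add_of_le hc
      simp only [Nat.add_sub_cancel_left]
      ring
    · simp [H.zero A (Finset.mem_powerset.1 hA) hc j]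
  rw [h1, H.tot j, he, ← Finset.card_add_card_compl V] at h2
  linarith [h2, mul_comm V.card r, mul_add r V.card Vᶜ.card]

/-- One vertex `v` can be detached from the amalgamated vertex. In each hyperedge the vertex `v`
takes over a fraction `1 / #Vᶜ` of the occurrences of the amalgamated vertex, on average over the
hyperedges of the same kind and color; these averages have integral sums, and
`Finset.exists_nat_matrix_of_real` makes them integral. -/
theorem exists_insert (H : IsAmalgamation h e r V x) (he : h * e = r * Fintype.card α)
    {v : α} (hv : v ∉ V) :
    ∃ x' : Finset α → κ → ℕ, IsAmalgamation h e r (insert v V) x' ∧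
      ∀ A ⊆ V, A.card = h → ∀ j, x' A j = x A j := by
  obtain ⟨s, hs⟩ : ∃ s, Vᶜ.card = s + 1 :=
    Nat.exists_eq_add_one.2 (Finset.card_pos.2 ⟨v, by simpa using hv⟩)
  have hs' : (insert v V)ᶜ.card = s := by
    rw [Finset.card_compl, Finset.card_insert_of_notMem hv]
    rw [Finset.card_compl] at hs
    omega
  have hs0 : (0 : ℝ) < s + 1 := by positivity
  obtain ⟨y, hyx, hyR, hyC⟩ := Finset.exists_nat_matrix_of_real V.powerset x
    (fun A j => (x A j : ℝ) * ((h - A.card : ℕ) : ℝ) / (s + 1)) (fun A _ j => by positivity)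
    (by
      intro A hA j
      rw [div_le_iff₀ hs0]
      rcases Nat.eq_zero_or_pos (x A j) with h0 | hpos
      · simp [h0]
      refine mul_le_mul_of_nonneg_left ?_ (by positivity)
      have hA' := Finset.mem_powerset.1 hA
      rcases lt_or_ge h A.card with hc | hc
      · simp [H.zero A hA' hc j] at hpos
      -- a multiset that occurs contains `∞` at most as often as there are amalgamated vertices
      have := H.mult A hA' hc
      rw [hs] at this
      by_contra! hlt
      rw [Nat.choose_eq_zero_of_lt (by exact_mod_cast hlt), Finset.sum_eq_zero_iff] at this
      exact hpos.ne' (this j (Finset.mem_univ j)))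
    (fun A => if A.card < h then s.choose (h - A.card - 1) else 0) (fun _ => r)
    (by
      intro A hA
      have hA' := Finset.mem_powerset.1 hA
      split_ifs with hc
      · rw [← Finset.sum_div, ← Finset.sum_mul, div_eq_iff hs0.ne']
        have h1 := H.mult A hA' hc.le
        obtain ⟨k, hk⟩ : ∃ k, h - A.card = k + 1 := Nat.exists_eq_add_one.2 (by omega)
        rw [hs, hk] at h1
        rw [hk, Nat.add_sub_cancel]
        have h2 := Nat.add_one_mul_choose_eq s k
        rw [← h1, mul_comm (s + 1)] at h2
        exact_mod_cast h2.symm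
      · have : h - A.card = 0 := by omega
        simp [this])
    (by
      intro j
      rw [← Finset.sum_div, div_eq_iff hs0.ne']
      have := H.sum_mul_sub he j
      rw [hs] at this
      exact_mod_cast this)
  have hy0 : ∀ A ⊆ V, h ≤ A.card → ∀ j, y A j = 0 := by
    intro A hA hc j
    have := hyR A (Finset.mem_powerset.2 hA)
    rw [if_neg (by omega), Finset.sum_eq_zero_iff] at this
    exact this j (Finset.mem_univ j)
  -- `y A j` copies of `A ∪ {∞, …, ∞}` in color `j` become copies of `A ∪ {v, ∞, …, ∞}`
  set x' : Finset α → κ → ℕ := fun A j => if v ∈ A then y (A.erase v) j else x A j - y A j with hx'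
  have hx'V : ∀ A ⊆ V, ∀ j, x' A j = x A j - y A j := fun A hA j => by
    have hvA : v ∉ A := fun hvA => hv (hA hvA)
    simp [hx', hvA]
  have hx'ins : ∀ A ⊆ V, ∀ j, x' (insert v A) j = y A j := fun A hA j => by
    simp [hx', Finset.erase_insert fun hvA => hv (hA hvA)]
  have hsum : ∀ A ⊆ V, ∀ j, x' A j + x' (insert v A) j = x A j := fun A hA j => by
    rw [hx'V A hA, hx'ins A hA, Nat.sub_add_cancel (hyx A (Finset.mem_powerset.2 hA) j)]
  refine ⟨x', ⟨?_, ?_, ?_, ?_⟩, ?_⟩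
  · intro A hA hc
    rw [hs']
    by_cases hvA : v ∈ A
    · have hAV : A.erase v ⊆ V := Finset.subset_insert_iff.1 hA
      have hcard := Finset.card_erase_add_one hvA
      have := hyR (A.erase v) (Finset.mem_powerset.2 hAV)
      rw [if_pos (by omega)] at this
      simp only [hx', hvA, if_true, this]
      congr 1
      omega
    · have hAV : A ⊆ V := (Finset.subset_insert_iff_of_notMem hvA).1 hA
      have h1 : ∑ j, x' A j + ∑ j, y A j = ∑ j, x A j := by
        rw [← Finset.sum_add_distrib]
        exact Finset.sum_congr rfl fun j _ => by rw [← hsum A hAV, hx'ins A hAV]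
      rw [hyR A (Finset.mem_powerset.2 hAV), H.mult A hAV hc, hs] at h1
      split_ifs at h1 with hc'
      · obtain ⟨k, hk⟩ : ∃ k, h - A.card = k + 1 := Nat.exists_eq_add_one.2 (by omega)
        rw [hk, Nat.choose_succ_succ, Nat.add_sub_cancel] at h1
        rw [hk]
        simp only [Nat.succ_eq_add_one] at h1
        omega
      · have : h - A.card = 0 := by omega
        rw [this] at h1 ⊢
        simpa using h1
  · intro A hA hc j
    by_cases hvA : v ∈ A
    · have hcard := Finset.card_erase_add_one hvA
      simp only [hx', hvA, if_true]
      exact hy0 _ (by rwa [← Finset.subset_insert_iff]) (by omega) j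
    · have hAV : A ⊆ V := (Finset.subset_insert_iff_of_notMem hvA).1 hA
      rw [hx'V A hAV, H.zero A hAV hc, Nat.zero_sub]
  · intro u hu j
    rw [Finset.sum_filter, Finset.sum_powerset_insert hv]
    by_cases huv : u = v
    · subst huv
      rw [Finset.sum_eq_zero, zero_add, ← hyC j]
      · exact Finset.sum_congr rfl fun A hA => by
          simp [hx'ins A (Finset.mem_powerset.1 hA)]
      · intro A hA
        exact if_neg fun huA => hv (Finset.mem_powerset.1 hA huA)
    · have huV : u ∈ V := Finset.mem_of_mem_insert_of_ne hu huv
      rw [← H.deg u huV j, Finset.sum_filter, ← Finset.sum_add_distrib]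
      refine Finset.sum_congr rfl fun A hA => ?_
      simp only [Finset.mem_insert, huv, false_or]
      split_ifs
      · exact hsum A (Finset.mem_powerset.1 hA) j
      · rfl
  · intro j
    rw [Finset.sum_powerset_insert hv, ← Finset.sum_add_distrib, ← H.tot j]
    exact Finset.sum_congr rfl fun A hA => hsum A (Finset.mem_powerset.1 hA) j
  · intro A hA hc j
    rw [hx'V A hA, hy0 A hA hc.ge, Nat.sub_zero]

/-- All vertices can be detached from the amalgamated vertex. -/
theorem exists_univ (H : IsAmalgamation h e r V x) (he : h * e = r * Fintype.card α) :
    ∃ x' : Finset α → κ → ℕ, IsAmalgamation h e r Finset.univ x' ∧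
      ∀ A ⊆ V, A.card = h → ∀ j, x' A j = x A j := by
  induction hs : Vᶜ.card generalizing V x with
  | zero =>
    rw [Finset.card_eq_zero, Finset.compl_eq_empty_iff] at hs
    subst hs
    exact ⟨x, H, fun _ _ _ _ => rfl⟩
  | succ s ih =>
    obtain ⟨v, hv⟩ := Finset.card_pos.1 (by omega : 0 < Vᶜ.card)
    have hv' : v ∉ V := Finset.mem_compl.1 hv
    obtain ⟨x₁, H₁, h₁⟩ := H.exists_insert he hv'
    obtain ⟨x₂, H₂, h₂⟩ := ih H₁ (by
      rw [Finset.card_compl, Finset.card_insert_of_notMem hv']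
      rw [Finset.card_compl] at hs
      omega)
    exact ⟨x₂, H₂, fun A hA hc j => by
      rw [h₂ A (hA.trans (Finset.subset_insert v V)) hc, h₁ A hA hc]⟩

end IsAmalgamation

end Detachment

/-! ### Coloring the hyperedges through the amalgamated vertex -/

section Counting

lemma Finset.sum_powerset_card_eq_sum_range {α : Type*} (W : Finset α) (N : ℕ) (f : ℕ → ℕ)
    (hf : ∀ i, N ≤ i → f i = 0) :
    ∑ A ∈ W.powerset, f A.card = ∑ i ∈ Finset.range N, W.card.choose i * f i := by
  rw [Finset.sum_powerset_apply_card]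
  simp only [smul_eq_mul]
  rw [Finset.sum_subset (s₂ := Finset.range (W.card + 1 + N)),
    Finset.sum_subset (s₁ := Finset.range N) (s₂ := Finset.range (W.card + 1 + N))]
  · intro i hi
    simp only [Finset.mem_range] at *
    omega
  · intro i _ hi
    rw [hf i (by simpa using hi), mul_zero]
  · intro i hi
    simp only [Finset.mem_range] at *
    omega
  · intro i _ hi
    rw [Nat.choose_eq_zero_of_lt (by simp only [Finset.mem_range] at hi; omega), zero_mul]

/-- The sets that contain `v` correspond to the subsets of `V.erase v`. -/
lemma Finset.sum_powerset_filter_mem {α : Type*} [DecidableEq α] {V : Finset α} {v : α}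
    (hv : v ∈ V) (F : Finset α → ℕ) :
    ∑ A ∈ V.powerset with v ∈ A, F A = ∑ A ∈ (V.erase v).powerset, F (insert v A) := by
  rw [Finset.sum_filter]
  nth_rw 1 [← Finset.insert_erase hv]
  rw [Finset.sum_powerset_insert (Finset.notMem_erase v V), Finset.sum_eq_zero, zero_add]
  · simp
  · intro A hA
    exact if_neg fun hvA => Finset.notMem_erase v V (Finset.mem_powerset.1 hA hvA)

lemma Finset.sum_powerset_filter_mem_card {α : Type*} [DecidableEq α] {V : Finset α} {v : α}
    (hv : v ∈ V) (N : ℕ) (f : ℕ → ℕ) (hf : ∀ i, N < i → f i = 0) :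
    ∑ A ∈ V.powerset with v ∈ A, f A.card
      = ∑ i ∈ Finset.range N, (V.card - 1).choose i * f (i + 1) := by
  rw [Finset.sum_powerset_filter_mem hv, ← Finset.card_erase_of_mem hv,
    ← Finset.sum_powerset_card_eq_sum_range (V.erase v) N (fun i => f (i + 1))
      fun i hi => hf _ (Nat.lt_succ_of_le hi)]
  refine Finset.sum_congr rfl fun A hA => ?_
  rw [Finset.card_insert_of_notMem fun hvA =>
    Finset.notMem_erase v V (Finset.mem_powerset.1 hA hvA)]

end Counting

section Initial

variable {α κ : Type*} [Fintype α] [DecidableEq α] [Fintype κ]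

/-- If the hyperedges of an amalgamation of the complete `3`-uniform hypergraph that contain the
amalgamated vertex at most once are colored with degrees at most `r`, then the hyperedges `{v, ∞, ∞}`
can be colored so as to make all degrees at vertices `v ∈ V` equal to `r`, and the hyperedges
`{∞, ∞, ∞}` so as to bring each color class to `e` hyperedges. The hypothesis `hbound` says that
the color classes do not exceed `e` hyperedges before the last step. -/
lemma exists_isAmalgamation_three {e r : ℕ} (V : Finset α) (y : Finset α → κ → ℕ)
    (hκ : Fintype.card κ * r = (Fintype.card α - 1).choose 2) (he : 3 * e = r * Fintype.card α)
    (hy : ∀ A ⊆ V, A.card ≠ 2 → A.card ≠ 3 → ∀ j, y A j = 0)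
    (hy2 : ∀ A ⊆ V, A.card = 2 → ∑ j, y A j = Vᶜ.card)
    (hy3 : ∀ A ⊆ V, A.card = 3 → ∑ j, y A j = 1)
    (hdeg : ∀ v ∈ V, ∀ j, ∑ A ∈ V.powerset with v ∈ A, y A j ≤ r)
    (hbound : ∀ j, r * V.card + ∑ A ∈ V.powerset, y A j
      ≤ e + ∑ A ∈ V.powerset, A.card * y A j) :
    ∃ x : Finset α → κ → ℕ, IsAmalgamation 3 e r V x ∧
      ∀ A ⊆ V, A.card = 3 → ∀ j, x A j = y A j := by
  set s := Vᶜ.card with hs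
  have hms : V.card + s = Fintype.card α := Finset.card_add_card_compl V
  set D : α → κ → ℕ := fun v j => ∑ A ∈ V.powerset with v ∈ A, y A j with hD
  set u : Finset α → κ → ℕ := fun A j => ∑ v ∈ V, if A = {v} then r - D v j else 0 with hu
  set T : κ → ℕ := fun j => ∑ A ∈ V.powerset, (y A j + u A j) with hT
  set z : Finset α → κ → ℕ := fun A j => if A = ∅ then e - T j else 0 with hz
  have hu0 : ∀ A, A.card ≠ 1 → ∀ j, u A j = 0 := fun A hA j =>
    Finset.sum_eq_zero fun v _ => if_neg fun h => hA (by simp [h])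
  have hu1 : ∀ v ∈ V, ∀ j, u {v} j = r - D v j := by
    intro v hv j
    simp [hu, Finset.singleton_inj, Finset.sum_ite_eq, hv]
  have hz0 : ∀ A, A.card ≠ 0 → ∀ j, z A j = 0 := fun A hA j =>
    if_neg fun h => hA (by simp [h])
  -- `T j` counts the hyperedges of color `j` before the hyperedges `{∞, ∞, ∞}` are colored
  have hTe : ∀ j, T j ≤ e := by
    intro j
    have h1 : ∑ A ∈ V.powerset, u A j = ∑ v ∈ V, (r - D v j) := by
      rw [Finset.sum_comm]
      refine Finset.sum_congr rfl fun v hv => ?_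
      rw [Finset.sum_ite_eq', if_pos (by simpa using hv)]
    have h2 : ∑ v ∈ V, (r - D v j) + ∑ A ∈ V.powerset, A.card * y A j = V.card * r := by
      rw [Finset.sum_powerset_card_mul V fun A => y A j, ← Finset.sum_add_distrib,
        Finset.sum_congr rfl fun v hv => Nat.sub_add_cancel (hdeg v hv j)]
      simp
    have h3 := hbound j
    simp only [hT, Finset.sum_add_distrib, h1]
    linarith [mul_comm r V.card]
  have hmult : ∀ A ⊆ V, A.card = 1 ∨ A.card = 2 ∨ A.card = 3 →
      ∑ j, (y A j + u A j) = s.choose (3 - A.card) := by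
    rintro A hA (hc | hc | hc)
    · obtain ⟨v, rfl⟩ := Finset.card_eq_one.1 hc
      have hv : v ∈ V := hA (by simp)
      have hmpos : 0 < V.card := Finset.card_pos.2 ⟨v, hv⟩
      have h1 : ∑ j, (r - D v j) + ∑ j, D v j = Fintype.card κ * r := by
        rw [← Finset.sum_add_distrib,
          Finset.sum_congr rfl fun j _ => Nat.sub_add_cancel (hdeg v hv j)]
        simp
      have h2 : ∑ j, D v j = (V.card - 1) * s + (V.card - 1).choose 2 := by
        rw [Finset.sum_comm]
        trans ∑ A ∈ V.powerset with v ∈ A, (fun i => if i = 2 then s else if i = 3 then 1 else 0)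
          A.card
        · refine Finset.sum_congr rfl fun A hA => ?_
          have hA' := Finset.mem_powerset.1 (Finset.mem_filter.1 hA).1
          simp only
          split_ifs with h2 h3
          · exact hy2 A hA' h2
          · exact hy3 A hA' h3
          · exact Finset.sum_eq_zero fun j _ => hy A hA' h2 h3 j
        · refine (Finset.sum_powerset_filter_mem_card hv 3
            (fun i => if i = 2 then s else if i = 3 then 1 else 0) fun i hi => ?_).trans ?_
          · simp [show i ≠ 2 by omega, show i ≠ 3 by omega]
          · simp [Finset.sum_range_succ]
      have h3 : (Fintype.card α - 1).choose 2
          = s.choose 2 + ((V.card - 1) * s + (V.card - 1).choose 2) := by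
        rw [← hms, show V.card + s - 1 = (V.card - 1) + s by omega, Nat.add_choose_eq]
        simp [Finset.Nat.antidiagonal_succ]
      rw [Finset.sum_congr rfl fun j _ => by
        rw [hy {v} hA (by simp) (by simp) j, zero_add, hu1 v hv j]]
      rw [hc, show 3 - 1 = 2 from rfl]
      omega
    · simp only [hu0 A (by omega), add_zero, hy2 A hA hc, hc]
      simp
    · simp only [hu0 A (by omega), add_zero, hy3 A hA hc, hc]
      simp
  refine ⟨fun A j => y A j + u A j + z A j, ⟨?_, ?_, ?_, ?_⟩, ?_⟩
  · intro A hA hc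
    rcases Nat.eq_zero_or_pos A.card with h0 | h0
    · obtain rfl := Finset.card_eq_zero.1 h0
      have h1 : ∑ j, T j = V.card * s.choose 2 + V.card.choose 2 * s + V.card.choose 3 := by
        rw [Finset.sum_comm]
        trans ∑ A ∈ V.powerset,
          (fun i => if i = 1 ∨ i = 2 ∨ i = 3 then s.choose (3 - i) else 0) A.card
        · refine Finset.sum_congr rfl fun A hA => ?_
          have hA' := Finset.mem_powerset.1 hA
          simp only
          split_ifs with hc
          · exact hmult A hA' hc
          · push Not at hc
            exact Finset.sum_eq_zero fun j _ => by
              rw [hy A hA' hc.2.1 hc.2.2, hu0 A hc.1, add_zero]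
        · refine (Finset.sum_powerset_card_eq_sum_range V 4
            (fun i => if i = 1 ∨ i = 2 ∨ i = 3 then s.choose (3 - i) else 0) fun i hi => ?_).trans ?_
          · exact if_neg (by omega)
          · simp [Finset.sum_range_succ]
      have h2 : ∑ j, (e - T j) + ∑ j, T j = Fintype.card κ * e := by
        rw [← Finset.sum_add_distrib,
          Finset.sum_congr rfl fun j _ => Nat.sub_add_cancel (hTe j)]
        simp
      have h3 : Fintype.card κ * e = (Fintype.card α).choose 3 := by
        have h4 : 3 * (Fintype.card κ * e) = 3 * (Fintype.card α).choose 3 := by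
          calc 3 * (Fintype.card κ * e) = Fintype.card κ * (3 * e) := by ring
            _ = Fintype.card α * (Fintype.card κ * r) := by rw [he]; ring
            _ = 3 * (Fintype.card α).choose 3 := by
              rw [hκ]
              rcases Nat.eq_zero_or_pos (Fintype.card α) with h | h
              · simp [h]
              · obtain ⟨N, hN⟩ := Nat.exists_eq_add_one.2 h
                rw [hN, Nat.add_sub_cancel, Nat.add_one_mul_choose_eq, mul_comm]
        omega
      have h5 : (Fintype.card α).choose 3
          = s.choose 3 + (V.card * s.choose 2 + V.card.choose 2 * s + V.card.choose 3) := by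
        rw [← hms, Nat.add_choose_eq]
        simp [Finset.Nat.antidiagonal_succ]
        ring
      rw [Finset.sum_congr rfl fun j _ => by
        rw [hy ∅ hA (by simp) (by simp) j, hu0 ∅ (by simp), zero_add, zero_add]]
      simp only [hz, if_true, Finset.card_empty, Nat.sub_zero, ← hs]
      omega
    · simp only [hz0 A h0.ne', add_zero]
      exact hmult A hA (by omega)
  · intro A hA hc j
    simp only [hy A hA (by omega) (by omega), hu0 A (by omega), hz0 A (by omega), add_zero]
  · intro v hv j
    rw [Finset.sum_add_distrib, Finset.sum_add_distrib]
    have h1 : ∑ A ∈ V.powerset with v ∈ A, z A j = 0 :=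
      Finset.sum_eq_zero fun A hA =>
        hz0 A (Finset.card_ne_zero_of_mem (Finset.mem_filter.1 hA).2) j
    have h2 : ∑ A ∈ V.powerset with v ∈ A, u A j = r - D v j := by
      rw [Finset.sum_eq_single_of_mem {v} (by simpa using hv), hu1 v hv j]
      intro A hA hAv
      refine hu0 A (fun hc => hAv ?_) j
      obtain ⟨w, rfl⟩ := Finset.card_eq_one.1 hc
      rw [Finset.mem_singleton.1 (Finset.mem_filter.1 hA).2]
    rw [h1, h2]
    have := hdeg v hv j
    simp only [hD]
    omega
  · intro j
    rw [Finset.sum_add_distrib]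
    simp only [hz]
    rw [Finset.sum_ite_eq', if_pos (by simp)]
    exact Nat.add_sub_cancel' (hTe j)
  · intro A hA hc j
    simp only [hu0 A (by omega), hz0 A (by omega), add_zero]

/-- Greedy coloring of the hyperedges `{u, v, ∞}`: a partial coloring `p₀` in which all degrees are
at most `r` extends to a coloring of all these hyperedges. If a maximal partial coloring leaves a
hyperedge `{u, v, ∞}` uncolored, then every color class has degree `r` at `u` or at `v`; but
`hquad` says that there are too few hyperedges at `u` and `v` for that. -/
lemma exists_pair_coloring {r : ℕ} (V : Finset α) (t p₀ : Finset α → κ → ℕ)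
    (ht : ∀ A ⊆ V, A.card ≠ 3 → ∀ j, t A j = 0)
    (ht3 : ∀ A ⊆ V, A.card = 3 → ∑ j, t A j = 1)
    (hp₀ : ∀ A ⊆ V, A.card ≠ 2 → ∀ j, p₀ A j = 0)
    (hp₀s : ∀ A ⊆ V, A.card = 2 → ∑ j, p₀ A j ≤ Vᶜ.card)
    (hdeg : ∀ v ∈ V, ∀ j, ∑ A ∈ V.powerset with v ∈ A, (t A j + p₀ A j) ≤ r)
    (hquad : 2 * ((V.card - 1).choose 2 + (V.card - 1) * Vᶜ.card) < Fintype.card κ * r + 2) :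
    ∃ p : Finset α → κ → ℕ, (∀ A ⊆ V, A.card ≠ 2 → ∀ j, p A j = 0) ∧
      (∀ A ⊆ V, A.card = 2 → ∑ j, p A j = Vᶜ.card) ∧
      (∀ v ∈ V, ∀ j, ∑ A ∈ V.powerset with v ∈ A, (t A j + p A j) ≤ r) ∧
      ∀ A j, p₀ A j ≤ p A j := by
  classical
  set s := Vᶜ.card with hs
  let S : Set (Finset α → κ → ℕ) := {p | (∀ A ⊆ V, A.card ≠ 2 → ∀ j, p A j = 0) ∧
      (∀ A ⊆ V, A.card = 2 → ∑ j, p A j ≤ s) ∧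
      (∀ v ∈ V, ∀ j, ∑ A ∈ V.powerset with v ∈ A, (t A j + p A j) ≤ r) ∧
      ∀ A j, p₀ A j ≤ p A j}
  obtain ⟨p, ⟨hp, hps, hpdeg, hpp₀⟩, hmin⟩ :=
    (measure fun p : Finset α → κ → ℕ => ∑ A ∈ V.powersetCard 2, (s - ∑ j, p A j)).wf.has_min S
      ⟨p₀, hp₀, hp₀s, hdeg, fun _ _ => le_rfl⟩
  refine ⟨p, hp, fun A₀ hA₀ hc₀ => (hps A₀ hA₀ hc₀).antisymm ?_, hpdeg, hpp₀⟩
  by_contra! hlt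
  -- a color in which both vertices of `A₀` have degree less than `r`
  obtain ⟨j₀, hj₀⟩ : ∃ j, ∀ v ∈ A₀, ∑ A ∈ V.powerset with v ∈ A, (t A j + p A j) < r := by
    by_contra! H
    obtain ⟨a, b, hab, rfl⟩ := Finset.card_eq_two.1 hc₀
    have haV : a ∈ V := hA₀ (by simp)
    have hbV : b ∈ V := hA₀ (by simp)
    have key : ∀ v ∈ ({a, b} : Finset α),
        ∑ j, ∑ A ∈ V.powerset with v ∈ A, (t A j + p A j)
          < (V.card - 1).choose 2 + (V.card - 1) * s := by
      intro v hv
      have hvV := hA₀ hv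
      have hle : ∀ A ∈ V.powerset.filter (v ∈ ·), ∑ j, (t A j + p A j)
          ≤ (fun i => if i = 2 then s else if i = 3 then 1 else 0) A.card := by
        intro A hA
        have hA' := Finset.mem_powerset.1 (Finset.mem_filter.1 hA).1
        rw [Finset.sum_add_distrib]
        simp only
        split_ifs with h2 h3
        · rw [Finset.sum_eq_zero fun j _ => ht A hA' (by omega) j, zero_add]
          exact hps A hA' h2
        · rw [Finset.sum_eq_zero fun j _ => hp A hA' (by omega) j, add_zero, ht3 A hA' h3]
        · rw [Finset.sum_eq_zero fun j _ => hp A hA' h2 j,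
            Finset.sum_eq_zero fun j _ => ht A hA' h3 j, add_zero]
      calc ∑ j, ∑ A ∈ V.powerset with v ∈ A, (t A j + p A j)
          = ∑ A ∈ V.powerset with v ∈ A, ∑ j, (t A j + p A j) := Finset.sum_comm
        _ < ∑ A ∈ V.powerset with v ∈ A,
            (fun i => if i = 2 then s else if i = 3 then 1 else 0) A.card := by
          refine Finset.sum_lt_sum hle ⟨{a, b}, by simpa [hA₀] using hv, ?_⟩
          simp only [hc₀, if_true]
          rw [Finset.sum_add_distrib, Finset.sum_eq_zero fun j _ => ht _ hA₀ (by omega) j,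
            zero_add]
          exact hlt
        _ = (V.card - 1).choose 2 + (V.card - 1) * s := by
          refine (Finset.sum_powerset_filter_mem_card hvV 3
            (fun i => if i = 2 then s else if i = 3 then 1 else 0) fun i hi => ?_).trans ?_
          · simp [show i ≠ 2 by omega, show i ≠ 3 by omega]
          · simp [Finset.sum_range_succ, add_comm]
    have hr : Fintype.card κ * r ≤ ∑ j, ((∑ A ∈ V.powerset with a ∈ A, (t A j + p A j))
        + ∑ A ∈ V.powerset with b ∈ A, (t A j + p A j)) := by
      rw [← smul_eq_mul, ← Finset.card_univ]
      refine Finset.card_nsmul_le_sum _ _ _ fun j _ => ?_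
      obtain ⟨v, hv, hrv⟩ := H j
      simp only [Finset.mem_insert, Finset.mem_singleton] at hv
      rcases hv with rfl | rfl
      · exact hrv.trans (Nat.le_add_right _ _)
      · exact hrv.trans (Nat.le_add_left _ _)
    rw [Finset.sum_add_distrib] at hr
    have h1 := key a (by simp)
    have h2 := key b (by simp)
    omega
  set p' : Finset α → κ → ℕ := fun A j => p A j + if A = A₀ then (if j = j₀ then 1 else 0) else 0
    with hp'
  have hsum' : ∀ A, ∑ j, p' A j = ∑ j, p A j + if A = A₀ then 1 else 0 := by
    intro A
    simp only [hp', Finset.sum_add_distrib]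
    split_ifs <;> simp
  refine hmin p' ⟨?_, ?_, ?_, ?_⟩ ?_
  · intro A hA hc j
    simp only [hp', hp A hA hc j, zero_add]
    exact if_neg fun h => hc (by rw [h, hc₀])
  · intro A hA hc
    rw [hsum']
    split_ifs with h
    · subst h
      exact hlt
    · exact hps A hA hc
  · intro v hv j
    have h1 : ∑ A ∈ V.powerset with v ∈ A, (t A j + p' A j)
        = ∑ A ∈ V.powerset with v ∈ A, (t A j + p A j)
          + if v ∈ A₀ then (if j = j₀ then 1 else 0) else 0 := by
      simp only [hp', ← add_assoc]
      rw [Finset.sum_add_distrib, Finset.sum_ite_eq']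
      simp [hA₀]
    rw [h1]
    by_cases hvA : v ∈ A₀
    · by_cases hj : j = j₀
      · subst hj
        simpa [hvA] using hj₀ v hvA
      · simpa [hvA, hj] using hpdeg v hv j
    · simpa [hvA] using hpdeg v hv j
  · intro A j
    exact (hpp₀ A j).trans (Nat.le_add_right _ _)
  · change ∑ A ∈ V.powersetCard 2, (s - ∑ j, p' A j) < ∑ A ∈ V.powersetCard 2, (s - ∑ j, p A j)
    refine Finset.sum_lt_sum (fun A _ => ?_)
      ⟨A₀, Finset.mem_powersetCard.2 ⟨hA₀, hc₀⟩, ?_⟩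
    · rw [hsum']
      omega
    · rw [hsum', if_pos rfl]
      omega

end Initial

/-! ### Extending colorings of triples -/

/-- If `#κ * ρ = 7`, one can choose `ρ` pairs in a `3`-element set for every color, with
multiplicities, such that every pair is chosen at most `3` times: number the `7` choices and go
through the three pairs cyclically. -/
lemma exists_pairs_of_card_eq_three {α κ : Type*} [DecidableEq α] [Fintype κ] {ρ : ℕ}
    (V : Finset α) (hV : V.card = 3) (hρ : Fintype.card κ * ρ = 7) :
    ∃ p : Finset α → κ → ℕ, (∀ A, A.card ≠ 2 → ∀ j, p A j = 0) ∧ (∀ A, ∑ j, p A j ≤ 3) ∧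
      ∀ j, ∑ A ∈ V.powerset, p A j = ρ := by
  classical
  have e₁ : κ × Fin ρ ≃ Fin 7 := Fintype.equivFinOfCardEq (by simpa using hρ)
  have e₂ : V.powersetCard 2 ≃ Fin 3 :=
    Fintype.equivFinOfCardEq (by rw [Fintype.card_coe, Finset.card_powersetCard, hV]; rfl)
  set g : κ × Fin ρ → V.powersetCard 2 :=
    fun b => e₂.symm ⟨e₁ b % 3, Nat.mod_lt _ (by norm_num)⟩ with hg
  have hgV : ∀ b, (g b : Finset α) ⊆ V ∧ (g b : Finset α).card = 2 := fun b =>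
    Finset.mem_powersetCard.1 (g b).2
  refine ⟨fun A j => ∑ i, if (g (j, i) : Finset α) = A then 1 else 0, ?_, ?_, ?_⟩
  · intro A hA j
    exact Finset.sum_eq_zero fun i _ => if_neg fun h => hA (by rw [← h, (hgV (j, i)).2])
  · intro A
    simp only
    rw [← Fintype.sum_prod_type' (f := fun j i => if (g (j, i) : Finset α) = A then 1 else 0),
      ← Finset.card_filter]
    by_cases hA : A ∈ V.powersetCard 2
    · have hfib : ∀ i : Fin 3,
          (Finset.univ.filter fun a : Fin 7 => (a : ℕ) % 3 = i).card ≤ 3 := by decide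
      refine le_trans (Finset.card_le_card_of_injOn e₁ (fun b hb => ?_) e₁.injective.injOn)
        (hfib (e₂ ⟨A, hA⟩))
      have hb' : g b = ⟨A, hA⟩ := Subtype.ext (Finset.mem_filter.1 hb).2
      simp [← hb', hg]
    · rw [Finset.filter_false_of_mem, Finset.card_empty]
      · exact Nat.zero_le _
      · intro b _ h
        exact hA (h ▸ (g b).2)
  · intro j
    rw [Finset.sum_comm]
    simp [hgV]

lemma exists_eq_ite_of_sum_eq_one {κ : Type*} [Fintype κ] [DecidableEq κ] (f : κ → ℕ)
    (hf : ∑ j, f j = 1) :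
    ∃ j, ∀ j', f j' = if j = j' then 1 else 0 := by
  classical
  obtain ⟨j, -, hj⟩ := Finset.exists_ne_zero_of_sum_ne_zero (hf.trans_ne one_ne_zero)
  have h := Finset.add_sum_erase Finset.univ f (Finset.mem_univ j)
  refine ⟨j, fun j' => ?_⟩
  split_ifs with hjj
  · subst hjj
    omega
  · have h0 : ∑ i ∈ Finset.univ.erase j, f i = 0 := by omega
    exact Finset.sum_eq_zero_iff.1 h0 j' (by simp [Ne.symm hjj])

/-- A coloring `c` of the triples in `V` with all degrees at most `r` extends to a coloring `C` of
all triples with all degrees equal to `r`. The hypothesis `hcard` makes room for the color classes;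
in its second alternative the hyperedges `{u, v, ∞}` have to be distributed over all colors. -/
theorem exists_coloring_extension {α κ : Type*} [Fintype α] [DecidableEq α] [Fintype κ]
    [DecidableEq κ] {r : ℕ} (V : Finset α) (c : Finset α → κ)
    (hκ : Fintype.card κ * r = (Fintype.card α - 1).choose 2) (h3 : 3 ∣ r * Fintype.card α)
    (hc : ∀ v ∈ V, ∀ j, ∑ A ∈ V.powerset with v ∈ A,
      (if A.card = 3 ∧ c A = j then 1 else 0) ≤ r)
    (hquad : 2 * ((V.card - 1).choose 2 + (V.card - 1) * Vᶜ.card) < Fintype.card κ * r + 2)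
    (hcard : 3 * V.card ≤ Fintype.card α ∨ V.card = 3 ∧ Fintype.card α = 8) :
    ∃ C : Finset α → κ, (∀ A ⊆ V, A.card = 3 → C A = c A) ∧
      ∀ v j, ∑ A with v ∈ A, (if A.card = 3 ∧ C A = j then 1 else 0) = r := by
  classical
  obtain ⟨e, he⟩ := h3
  set t : Finset α → κ → ℕ := fun A j => if A.card = 3 ∧ c A = j then 1 else 0 with ht
  have ht0 : ∀ A ⊆ V, A.card ≠ 3 → ∀ j, t A j = 0 := fun A _ hA j => by simp [ht, hA]
  have ht3 : ∀ A ⊆ V, A.card = 3 → ∑ j, t A j = 1 := fun A _ hA => by simp [ht, hA]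
  obtain ⟨p, hp0, hp2, hpdeg, hpbound⟩ : ∃ p : Finset α → κ → ℕ,
      (∀ A ⊆ V, A.card ≠ 2 → ∀ j, p A j = 0) ∧
      (∀ A ⊆ V, A.card = 2 → ∑ j, p A j = Vᶜ.card) ∧
      (∀ v ∈ V, ∀ j, ∑ A ∈ V.powerset with v ∈ A, (t A j + p A j) ≤ r) ∧
      ∀ j, r * V.card + ∑ A ∈ V.powerset, (t A j + p A j)
        ≤ e + ∑ A ∈ V.powerset, A.card * (t A j + p A j) := by
    rcases hcard with hcard | ⟨hV, hα⟩
    · obtain ⟨p, hp0, hp2, hpdeg, -⟩ := exists_pair_coloring V t (fun _ _ => 0) ht0 ht3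
        (fun _ _ _ _ => rfl) (fun _ _ _ => by simp) (by simpa only [add_zero] using hc) hquad
      refine ⟨p, hp0, hp2, hpdeg, fun j => add_le_add ?_ (Finset.sum_le_sum fun A hA => ?_)⟩
      · nlinarith
      · have hA' := Finset.mem_powerset.1 hA
        rcases Nat.eq_zero_or_pos A.card with h | h
        · rw [ht0 A hA' (by omega), hp0 A hA' (by omega), add_zero, mul_zero]
        · exact Nat.le_mul_of_pos_left _ h
    · -- here `r = 3 * ρ`, and a color class has room for the last step as soon as `ρ` of its
      -- hyperedges are of the form `{u, v, ∞}`
      rw [hα] at he hκ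
      obtain ⟨ρ, rfl⟩ : 3 ∣ r := by omega
      have hρ : Fintype.card κ * ρ = 7 := by
        have : Fintype.card κ * (3 * ρ) = 21 := by rw [hκ]; rfl
        linarith
      have hρpos : 0 < ρ := Nat.pos_of_ne_zero (by rintro rfl; simp at hρ)
      obtain ⟨p₀, hp₀, hp₀s, hp₀V⟩ := exists_pairs_of_card_eq_three V hV hρ
      have hs : Vᶜ.card = 5 := by rw [Finset.card_compl, hV, hα]
      obtain ⟨p, hp0, hp2, hpdeg, hpp₀⟩ := exists_pair_coloring (r := 3 * ρ) V t p₀ ht0 ht3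
        (fun A _ => hp₀ A) (fun A _ _ => (hp₀s A).trans (by omega))
        (by
          intro v hv j
          rw [Finset.sum_add_distrib]
          have h1 : ∑ A ∈ V.powerset with v ∈ A, t A j ≤ 1 := by
            rw [← Finset.card_filter, Finset.card_le_one]
            intro A hA B hB
            simp only [Finset.mem_filter, Finset.mem_powerset] at hA hB
            rw [Finset.eq_of_subset_of_card_le hA.1.1 (by omega),
              Finset.eq_of_subset_of_card_le hB.1.1 (by omega)]
          have h2 : ∑ A ∈ V.powerset with v ∈ A, p₀ A j ≤ ρ := by
            rw [← hp₀V j]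
            exact Finset.sum_le_sum_of_subset (Finset.filter_subset _ _)
          omega)
        hquad
      refine ⟨p, hp0, hp2, hpdeg, fun j => ?_⟩
      have h1 : ∑ A ∈ V.powerset, (t A j + p A j) + ∑ A ∈ V.powerset, p₀ A j
          ≤ ∑ A ∈ V.powerset, A.card * (t A j + p A j) := by
        rw [← Finset.sum_add_distrib]
        refine Finset.sum_le_sum fun A hA => ?_
        have hA' := Finset.mem_powerset.1 hA
        have := hpp₀ A j
        rcases lt_or_ge A.card 2 with h | h
        · rw [ht0 A hA' (by omega), hp0 A hA' (by omega), hp₀ A (by omega)]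
          simp
        · nlinarith
      rw [hp₀V j] at h1
      rw [hV]
      omega
  obtain ⟨x, hx, hxy⟩ := exists_isAmalgamation_three V (fun A j => t A j + p A j) hκ he.symm
    (fun A hA h2 h3 j => by rw [ht0 A hA h3, hp0 A hA h2])
    (fun A hA h2 => by
      rw [Finset.sum_add_distrib, hp2 A hA h2,
        Finset.sum_eq_zero fun j _ => ht0 A hA (by omega) j, zero_add])
    (fun A hA h3 => by
      rw [Finset.sum_add_distrib, ht3 A hA h3,
        Finset.sum_eq_zero fun j _ => hp0 A hA (by omega) j, add_zero])
    hpdeg hpbound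
  obtain ⟨x', hx', hxx'⟩ := hx.exists_univ he.symm
  have hC : ∀ A : Finset α, ∃ j, ∀ j', x' A j' = if A.card = 3 ∧ j = j' then 1 else 0 := by
    intro A
    by_cases hA : A.card = 3
    · have := hx'.mult A (Finset.subset_univ A) hA.le
      rw [hA, Nat.sub_self, Nat.choose_zero_right] at this
      obtain ⟨j, hj⟩ := exists_eq_ite_of_sum_eq_one _ this
      exact ⟨j, by simpa [hA] using hj⟩
    · refine ⟨c A, fun j => ?_⟩
      rw [if_neg fun h => hA h.1]
      rcases lt_or_gt_of_ne hA with h | h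
      · have := hx'.mult A (Finset.subset_univ A) h.le
        rw [Finset.compl_univ, Finset.card_empty, Nat.choose_eq_zero_of_lt (by omega),
          Finset.sum_eq_zero_iff] at this
        exact this j (Finset.mem_univ j)
      · exact hx'.zero A (Finset.subset_univ A) h j
  choose C hC using hC
  refine ⟨C, fun A hA h3 => ?_, fun v j => ?_⟩
  · have h := hC A (c A)
    rw [hxx' A hA h3, hxy A hA h3, hp0 A hA (by omega)] at h
    by_contra hne
    simp [ht, h3, hne] at h
  · have h := hx'.deg v (Finset.mem_univ v) j
    rw [Finset.powerset_univ] at h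
    exact (Finset.sum_congr rfl fun A _ => (hC A j).symm).trans h

/-! ### Factorizations and their degrees -/

open scoped Hypergraph

namespace Hypergraph

variable {α : Type*} [Fintype α] [DecidableEq α]

open Classical in
lemma degree_eq_sum (H : Hypergraph α) (v : α) :
    H.degree v = ∑ A : Finset α with v ∈ A, if (A : Set α) ∈ E(H) then 1 else 0 := by
  rw [← Finset.card_filter, ← Set.ncard_coe_finset,
    ← Set.ncard_image_of_injective _ (Finset.coe_injective (α := α)), degree]
  congr 1
  ext e
  simp only [Set.mem_ofPred_eq, Finset.coe_filter, Finset.mem_filter, Finset.mem_univ, true_and,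
    Set.mem_image]
  constructor
  · rintro ⟨he, hv⟩
    exact ⟨e.toFinite.toFinset, by simpa using ⟨hv, he⟩, by simp⟩
  · rintro ⟨A, ⟨hv, hA⟩, rfl⟩
    exact ⟨hA, hv⟩

lemma degree_completeUniform_three {n : ℕ} (v : Fin n) :
    (completeUniform n 3).degree v = (n - 1).choose 2 := by
  classical
  rw [degree_eq_sum, ← Finset.powerset_univ]
  have h := Finset.sum_powerset_filter_mem_card (Finset.mem_univ v) 3
    (fun i => if i = 3 then 1 else 0) fun i hi => if_neg (by omega)
  simp only [Finset.sum_range_succ, Finset.card_univ, Fintype.card_fin] at h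
  simpa [completeUniform, Set.ncard_coe_finset] using h

/-- The handshake lemma for `3`-uniform `r`-regular hypergraphs. -/
lemma three_dvd_of_isFactor {n r : ℕ} {H : Hypergraph (Fin n)}
    (hH : (completeUniform n 3).IsFactor r H) : 3 ∣ r * n := by
  classical
  obtain ⟨⟨-, hE⟩, hV, hreg⟩ := hH
  have h := Finset.sum_powerset_card_mul (Finset.univ : Finset (Fin n))
    fun A => if (A : Set (Fin n)) ∈ E(H) then 1 else 0
  have hd : ∀ v ∈ (Finset.univ : Finset (Fin n)),
      ∑ A ∈ (Finset.univ : Finset (Fin n)).powerset with v ∈ A,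
        (if (A : Set (Fin n)) ∈ E(H) then 1 else 0) = r := by
    intro v _
    rw [Finset.powerset_univ, ← degree_eq_sum]
    exact hreg v (by rw [hV]; trivial)
  rw [Finset.sum_congr rfl hd, Finset.sum_const, Finset.card_univ, Fintype.card_fin, smul_eq_mul,
    mul_comm] at h
  rw [← h]
  refine Finset.dvd_sum fun A _ => ?_
  split_ifs with hA
  · have h3 : (A : Set (Fin n)).ncard = 3 := hE hA
    rw [Set.ncard_coe_finset] at h3
    rw [h3]
  · exact dvd_zero _

lemma finite_of_finite {α : Type*} [Finite α] : Finite (Hypergraph α) :=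
  Finite.of_injective (fun H : Hypergraph α => (V(H), E(H))) fun _ _ h =>
    Hypergraph.ext (congr_arg Prod.fst h) (congr_arg Prod.snd h)

/-- The degree of a vertex is `r` times the number of factors of an `r`-factorization. -/
lemma IsFactorization.ncard_mul {G : Hypergraph α} {r : ℕ} {S : Set (Hypergraph α)}
    (hS : G.IsFactorization r S) {v : α} (hv : v ∈ V(G)) : S.ncard * r = G.degree v := by
  classical
  have := finite_of_finite (α := α)
  have hfin : S.Finite := S.toFinite
  have hdeg : ∀ H ∈ hfin.toFinset,
      ∑ A : Finset α with v ∈ A, (if (A : Set α) ∈ E(H) then 1 else 0) = r := by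
    intro H hH
    have hf := hS.1 H (by simpa using hH)
    rw [← degree_eq_sum]
    exact hf.2.2 v (by rwa [hf.2.1])
  rw [degree_eq_sum, Set.ncard_eq_toFinset_card S hfin, ← smul_eq_mul, ← Finset.sum_const,
    ← Finset.sum_congr rfl hdeg, Finset.sum_comm]
  refine Finset.sum_congr rfl fun A _ => ?_
  split_ifs with hA
  · obtain ⟨H, ⟨hH, hAH⟩, huniq⟩ := hS.2 A hA
    rw [Finset.sum_eq_single H, if_pos hAH]
    · intro H' hH' hne
      exact if_neg fun h => hne (huniq H' ⟨by simpa using hH', h⟩)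
    · intro h
      exact absurd hH (by simpa using h)
  · refine Finset.sum_eq_zero fun H hH => if_neg fun h => hA ?_
    exact (hS.1 H (by simpa using hH)).1.2 h

/-- The conditions of an embedding into an `r`-factorization of `K_n^3` are necessary. -/
lemma necessary_of_embedsInFactorization {m n q r : ℕ} (hn : 3 ≤ n)
    (c : (completeUniform m 3).EdgeColoring q)
    (h : (completeUniform m 3).EmbedsInFactorization c (completeUniform n 3) r) :
    3 ∣ r * n ∧ r ∣ (n - 1).choose 2 ∧ q * r ≤ (n - 1).choose 2 ∧
      ∀ (v : Fin m) (j : Fin q), ((completeUniform m 3).colorClass c j).degree v ≤ r := by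
  obtain ⟨S, hS, f, hf, -, φ, hφ, hφS, hsub⟩ := h
  have := finite_of_finite (α := Fin n)
  have hcount : S.ncard * r = (n - 1).choose 2 :=
    (hS.ncard_mul (Set.mem_univ _)).trans (degree_completeUniform_three ⟨0, by omega⟩)
  refine ⟨?_, ⟨S.ncard, by rw [← hcount, mul_comm]⟩, ?_, fun v j => ?_⟩
  · have hpos : 0 < (n - 1).choose 2 := Nat.choose_pos (by omega)
    have hne : S.ncard ≠ 0 := by
      rintro h0
      simp [← hcount, h0] at hpos
    obtain ⟨H, hH⟩ := Set.nonempty_of_ncard_ne_zero hne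
    exact three_dvd_of_isFactor (hS.1 H hH)
  · rw [← hcount]
    refine Nat.mul_le_mul_right r ?_
    calc q = (Set.range φ).ncard := by
          rw [← Set.image_univ, Set.ncard_image_of_injective _ hφ, Set.ncard_univ, Nat.card_fin]
      _ ≤ S.ncard := Set.ncard_le_ncard (Set.range_subset_iff.2 hφS)
  · have hfac := hS.1 _ (hφS j)
    have hreg : (φ j).degree (f v) = r := hfac.2.2 (f v) (by rw [hfac.2.1]; trivial)
    have hinj : Function.Injective f := Set.injOn_univ.1 hf
    rw [← hreg]
    refine Set.ncard_le_ncard_of_injOn (f '' ·) (fun e he => ⟨?_, ?_⟩)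
      (Set.image_injective.2 hinj).injOn
    · exact (hsub j).2 (image_mem_edgeSet_image he.1)
    · exact Set.mem_image_of_mem f he.2

/-- The hypergraph on all of `α` formed by the triples of color `j`. The coloring is defined on all
finsets; its values on finsets that are not triples play no role. -/
def ofTripleColoring {α κ : Type*} (C : Finset α → κ) (j : κ) : Hypergraph α where
  vertexSet := Set.univ
  edgeSet := {e | ∃ A : Finset α, (A.card = 3 ∧ C A = j) ∧ (A : Set α) = e}
  subset_vertexSet_of_mem_edgeSet' := fun _ _ => Set.subset_univ _

lemma coe_mem_edgeSet_ofTripleColoring {α κ : Type*} (C : Finset α → κ) (j : κ) (A : Finset α) :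
    (A : Set α) ∈ E(ofTripleColoring C j) ↔ A.card = 3 ∧ C A = j := by
  constructor
  · rintro ⟨B, hB, hBA⟩
    rwa [← Finset.coe_injective hBA]
  · intro h
    exact ⟨A, h, rfl⟩

/-- The color classes of a coloring of the triples in which all degrees are `r` form an
`r`-factorization. -/
lemma isFactorization_range_ofTripleColoring {n r : ℕ} {κ : Type*} [DecidableEq κ]
    (C : Finset (Fin n) → κ)
    (hC : ∀ v j, ∑ A with v ∈ A, (if A.card = 3 ∧ C A = j then 1 else 0) = r) :
    (completeUniform n 3).IsFactorization r (Set.range (ofTripleColoring C)) := by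
  constructor
  · rintro _ ⟨j, rfl⟩
    refine ⟨⟨fun _ _ => trivial, ?_⟩, rfl, fun v _ => ?_⟩
    · rintro _ ⟨A, hA, rfl⟩
      exact (Set.ncard_coe_finset A).trans hA.1
    · classical
      rw [degree_eq_sum, ← hC v j]
      simp only [coe_mem_edgeSet_ofTripleColoring]
  · intro e he
    obtain ⟨A, rfl⟩ := e.toFinite.exists_finset_coe
    have hA : A.card = 3 := (Set.ncard_coe_finset A).symm.trans he
    refine ⟨_, ⟨⟨C A, rfl⟩, (coe_mem_edgeSet_ofTripleColoring C _ A).2 ⟨hA, rfl⟩⟩, ?_⟩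
    rintro _ ⟨⟨j, rfl⟩, hj⟩
    rw [((coe_mem_edgeSet_ofTripleColoring C _ A).1 hj).2]

lemma ofTripleColoring_injective {r : ℕ} (hr : 1 ≤ r) [Nonempty α] {κ : Type*} [DecidableEq κ]
    (C : Finset α → κ)
    (hC : ∀ v j, ∑ A with v ∈ A, (if A.card = 3 ∧ C A = j then 1 else 0) = r) :
    Function.Injective (ofTripleColoring C) := by
  intro j j' hjj
  obtain ⟨v⟩ := ‹Nonempty α›
  obtain ⟨A, -, hA⟩ := Finset.exists_ne_zero_of_sum_ne_zero ((hC v j).trans_ne (by omega))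
  have hA' : A.card = 3 ∧ C A = j := by
    by_contra h
    exact hA (if_neg h)
  have h := (coe_mem_edgeSet_ofTripleColoring C j A).2 hA'
  rw [hjj, coe_mem_edgeSet_ofTripleColoring] at h
  exact hA'.2.symm.trans h.2

end Hypergraph

/-- The second part of the conclusion is the lower bound on `n` solved for the quadratic inequality
that the greedy coloring needs. The third part follows since the lower bound exceeds `3 * m - 1`
for `m ≥ 4`, and `7` for `m = 3`. -/
lemma arithmetic_of_bound {m n : ℕ} (hm : 3 ≤ m)
    (h : (n : ℝ) > 2 * (m : ℝ) + (-1 + Real.sqrt (8 * (m : ℝ) ^ 2 - 16 * (m : ℝ) - 7)) / 2) :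
    m ≤ n ∧ 2 * ((m - 1).choose 2 + (m - 1) * (n - m)) < (n - 1).choose 2 + 2 ∧
      (3 * m ≤ n ∨ m = 3 ∧ n = 8) := by
  have hm' : (3 : ℝ) ≤ m := by exact_mod_cast hm
  have hsq := Real.sq_sqrt (show (0 : ℝ) ≤ 8 * (m : ℝ) ^ 2 - 16 * (m : ℝ) - 7 by nlinarith)
  set w := Real.sqrt (8 * (m : ℝ) ^ 2 - 16 * (m : ℝ) - 7) with hw
  have hw0 : 0 ≤ w := Real.sqrt_nonneg _
  have hwlt : w < 2 * n - 4 * m + 1 := by linarith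
  have hlt : 8 * (m : ℝ) ^ 2 - 16 * m - 7 < (2 * n - 4 * m + 1) ^ 2 := by
    rw [← hsq]
    exact pow_lt_pow_left₀ hwlt hw0 two_ne_zero
  have hmn : m ≤ n := by
    have : (m : ℝ) < n + 1 := by linarith
    exact Nat.lt_succ_iff.1 (by exact_mod_cast this)
  refine ⟨hmn, ?_, ?_⟩
  · have h1 := Nat.cast_choose_two ℝ (m - 1)
    have h2 := Nat.cast_choose_two ℝ (n - 1)
    rw [Nat.cast_sub (by omega), Nat.cast_one] at h1 h2
    have : ((2 * ((m - 1).choose 2 + (m - 1) * (n - m)) : ℕ) : ℝ)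
        < ((n - 1).choose 2 + 2 : ℕ) := by
      push_cast [Nat.cast_sub hmn, Nat.cast_sub (show 1 ≤ m by omega)]
      rw [h1, h2]
      nlinarith
    exact_mod_cast this
  · by_contra! hcon
    obtain ⟨h1, h2⟩ := hcon
    have h1' : (n : ℝ) + 1 ≤ 3 * m := by exact_mod_cast h1
    have hm4 : m < 4 := by
      have : (m : ℝ) < 4 := by nlinarith
      exact_mod_cast this
    obtain rfl : m = 3 := by omega
    have : (8 : ℝ) ≤ n := by
      by_contra! hn
      have hn7 : (n : ℝ) ≤ 7 := by
        have : n < 8 := by exact_mod_cast hn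
        exact_mod_cast Nat.lt_succ_iff.1 this
      norm_num at hlt hwlt
      nlinarith
    have : 8 ≤ n := by exact_mod_cast this
    exact h2 rfl (by omega)

/-! ### Embeddings from colorings -/

namespace Hypergraph

lemma embedsInFactorization_of_tripleColoring {m n q r : ℕ} (hr : 1 ≤ r) (hn : 3 ≤ n)
    (c : (completeUniform m 3).EdgeColoring q) {κ : Type*} [DecidableEq κ]
    (f : Fin m ↪ Fin n) (g : Fin q ↪ κ) (C : Finset (Fin n) → κ)
    (hC : ∀ v j, ∑ A with v ∈ A, (if A.card = 3 ∧ C A = j then 1 else 0) = r)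
    (hcC : ∀ (e : E(completeUniform m 3)) (A : Finset (Fin n)), f '' e = A → C A = g (c e)) :
    (completeUniform m 3).EmbedsInFactorization c (completeUniform n 3) r := by
  have : Nonempty (Fin n) := ⟨⟨0, by omega⟩⟩
  refine ⟨Set.range (ofTripleColoring C), isFactorization_range_ofTripleColoring C hC, f,
    f.injective.injOn, fun _ _ => trivial, fun j => ofTripleColoring C (g j),
    (ofTripleColoring_injective hr C hC).comp g.injective, fun j => ⟨_, rfl⟩, fun j =>
    ⟨fun _ _ => trivial, ?_⟩⟩
  rintro _ ⟨e, ⟨he, rfl⟩, rfl⟩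
  obtain ⟨A, hA⟩ := (f '' e).toFinite.exists_finset_coe
  rw [← hA, coe_mem_edgeSet_ofTripleColoring, hcC ⟨e, he⟩ A hA.symm]
  refine ⟨?_, rfl⟩
  rw [← Set.ncard_coe_finset, hA, Set.ncard_image_of_injective _ f.injective]
  exact he

/-- The conditions of an embedding into an `r`-factorization of `K_n^3` are sufficient. For `m < 3`
there is nothing to extend, and the amalgamation starts with no vertex detached. -/
lemma embedsInFactorization_of_conditions {m n q r k : ℕ} (hr : 1 ≤ r) (hn : 3 ≤ n)
    (hmn : 3 ≤ m → m ≤ n ∧ 2 * ((m - 1).choose 2 + (m - 1) * (n - m)) < (n - 1).choose 2 + 2 ∧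
      (3 * m ≤ n ∨ m = 3 ∧ n = 8))
    (c : (completeUniform m 3).EdgeColoring q) (h3 : 3 ∣ r * n) (hk : k * r = (n - 1).choose 2)
    (hq : q ≤ k)
    (hc : ∀ (v : Fin m) (j : Fin q), ((completeUniform m 3).colorClass c j).degree v ≤ r) :
    (completeUniform m 3).EmbedsInFactorization c (completeUniform n 3) r := by
  classical
  have hkpos : 0 < k := by
    refine Nat.pos_of_ne_zero ?_
    rintro rfl
    have : 0 < (n - 1).choose 2 := Nat.choose_pos (by omega)
    omega
  have hκ : Fintype.card (Fin k) * r = (Fintype.card (Fin n) - 1).choose 2 := by simpa using hk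
  have h3' : 3 ∣ r * Fintype.card (Fin n) := by simpa using h3
  rcases lt_or_ge m 3 with hm | hm
  · obtain ⟨C, -, hC⟩ := exists_coloring_extension (∅ : Finset (Fin n))
      (fun _ => (⟨0, hkpos⟩ : Fin k)) hκ h3' (by simp) (by simp) (by simp)
    refine embedsInFactorization_of_tripleColoring hr hn c (Fin.castLEEmb (by omega))
      (Fin.castLEEmb hq) C hC fun e => absurd (show (e : Set (Fin m)).ncard = 3 from e.2) ?_
    have := Set.ncard_le_ncard (Set.subset_univ (e : Set (Fin m)))
    rw [Set.ncard_univ, Nat.card_fin] at this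
    omega
  · obtain ⟨hmn, hquad, hcard⟩ := hmn hm
    set f : Fin m ↪ Fin n := Fin.castLEEmb hmn
    set g : Fin q ↪ Fin k := Fin.castLEEmb hq
    set V : Finset (Fin n) := Finset.univ.map f with hV
    have hVcard : V.card = m := by simp [hV]
    let c' : Finset (Fin n) → Fin k := fun A =>
      if h : ∃ e : E(completeUniform m 3), f '' e = A then g (c h.choose) else ⟨0, hkpos⟩
    have hc' : ∀ (e : E(completeUniform m 3)) (A : Finset (Fin n)), f '' e = A →
        c' A = g (c e) := by
      intro e A hA
      have h : ∃ e : E(completeUniform m 3), f '' e = A := ⟨e, hA⟩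
      have he : h.choose = e :=
        Subtype.ext (Set.image_injective.2 f.injective (h.choose_spec.trans hA.symm))
      simp only [c', dif_pos h, he]
    have hpre : ∀ A ⊆ V, A.card = 3 → ∃ e : E(completeUniform m 3), f '' e = A := by
      intro A hA hA3
      have himg : f '' (f ⁻¹' A) = A := by
        refine Set.image_preimage_eq_of_subset fun a ha => ?_
        obtain ⟨w, -, hw⟩ := Finset.mem_map.1 (hA ha)
        exact ⟨w, hw⟩
      refine ⟨⟨f ⁻¹' A, ?_⟩, himg⟩
      change (f ⁻¹' (A : Set (Fin n))).ncard = 3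
      rw [← Set.ncard_image_of_injective _ f.injective, himg, Set.ncard_coe_finset, hA3]
    have hdeg : ∀ v ∈ V, ∀ j, ∑ A ∈ V.powerset with v ∈ A,
        (if A.card = 3 ∧ c' A = j then 1 else 0) ≤ r := by
      intro v hv j
      obtain ⟨w, -, rfl⟩ := Finset.mem_map.1 hv
      by_cases hj : ∃ i, g i = j
      · obtain ⟨i, rfl⟩ := hj
        refine le_trans ?_ (hc w i)
        rw [← Finset.card_filter, ← Set.ncard_coe_finset]
        refine Set.ncard_le_ncard_of_injOn (fun A => f ⁻¹' (A : Set (Fin n))) ?_ ?_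
        · intro A hA
          simp only [Finset.coe_filter, Finset.mem_filter, Finset.mem_powerset,
            Set.mem_ofPred_eq] at hA
          obtain ⟨e, he⟩ := hpre A hA.1.1 hA.2.1
          have hpe : f ⁻¹' (A : Set (Fin n)) = e := by
            rw [← he, Set.preimage_image_eq _ f.injective]
          refine ⟨?_, hA.1.2⟩
          rw [hpe]
          exact ⟨e.2, g.injective ((hc' e A he).symm.trans hA.2.2)⟩
        · intro A hA B hB hAB
          simp only [Finset.coe_filter, Finset.mem_filter, Finset.mem_powerset,
            Set.mem_ofPred_eq] at hA hB hAB
          obtain ⟨e, he⟩ := hpre A hA.1.1 hA.2.1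
          obtain ⟨e', he'⟩ := hpre B hB.1.1 hB.2.1
          rw [← he, ← he', Set.preimage_image_eq _ f.injective,
            Set.preimage_image_eq _ f.injective] at hAB
          exact Finset.coe_injective (by rw [← he, ← he', hAB])
      · rw [Finset.sum_eq_zero]
        · exact Nat.zero_le r
        · intro A hA
          refine if_neg fun h => hj ?_
          obtain ⟨e, he⟩ := hpre A (Finset.mem_powerset.1 (Finset.mem_filter.1 hA).1) h.1
          exact ⟨c e, (hc' e A he).symm.trans h.2⟩
    obtain ⟨C, hCc, hC⟩ := exists_coloring_extension V c' hκ h3' hdeg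
      (by rw [hκ, Finset.card_compl, hVcard, Fintype.card_fin]; exact hquad)
      (by rw [hVcard, Fintype.card_fin]; exact hcard)
    refine embedsInFactorization_of_tripleColoring hr hn c f g C hC fun e A hA => ?_
    rw [hCc A, hc' e A hA]
    · intro a ha
      have ha' : a ∈ f '' (e : Set (Fin m)) := by rw [hA]; exact ha
      obtain ⟨w, -, rfl⟩ := ha'
      exact Finset.mem_map_of_mem f (Finset.mem_univ w)
    · rw [← Set.ncard_coe_finset, ← hA, Set.ncard_image_of_injective _ f.injective]
      exact e.2

end Hypergraph

theorem theorem3p1 (m n q r : ℕ) (hr : 1 ≤ r) (hn : 3 ≤ n)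
    (hmn : 3 ≤ m →
      (n : ℝ) > 2 * (m : ℝ) + (-1 + Real.sqrt (8 * (m : ℝ) ^ 2 - 16 * (m : ℝ) - 7)) / 2)
    (c : (Hypergraph.completeUniform m 3).EdgeColoring q) :
    (Hypergraph.completeUniform m 3).EmbedsInFactorization c
        (Hypergraph.completeUniform n 3) r ↔
      3 ∣ r * n ∧
      r ∣ (n - 1).choose 2 ∧
      (q : ℝ) ≤ ((n - 1).choose 2 : ℝ) / (r : ℝ) ∧
      ∀ (v : Fin m) (j : Fin q),
        ((Hypergraph.completeUniform m 3).colorClass c j).degree v ≤ r := by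
  have hr' : (0 : ℝ) < r := by exact_mod_cast hr
  rw [le_div_iff₀ hr']
  constructor
  · intro h
    obtain ⟨h1, h2, h3, h4⟩ := Hypergraph.necessary_of_embedsInFactorization hn c h
    exact ⟨h1, h2, by exact_mod_cast h3, h4⟩
  · rintro ⟨h1, ⟨k, hk⟩, h3, h4⟩
    have hk' : k * r = (n - 1).choose 2 := by rw [hk, mul_comm]
    have h3' : q * r ≤ k * r := by
      rw [hk']
      exact_mod_cast h3
    exact Hypergraph.embedsInFactorization_of_conditions hr hn
      (fun hm => arithmetic_of_bound hm (hmn hm)) c h1 hk' (Nat.le_of_mul_le_mul_right h3' hr) h4
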